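/- Let $n \ge 1$ and let $\mathcal{H}_n$ be the real vector space of $n\times n$ complex Hermitian matrices. A matrix $A\in\mathcal{H}_n$ is positive definite if $x^*Ax>0$ for all nonzero $x\in\mathbb{C}^n$; let $\mathrm{PD}_n\subseteq\mathcal{H}_n$ be the set of positive definite matrices. Let $\mathcal{L}:\mathcal{H}_n\to\mathcal{H}_n$ be a real-linear operator. Then $\mathcal{L}(\mathrm{PD}_n)=\mathrm{PD}_n$ if and only if there is an invertible matrix $R\in\mathbb{C}^{n\times n}$ such that either $\mathcal{L}(A)=RAR^*$ for all $A\in\mathcal{H}_n$, or $\mathcal{L}(A)=RA^TR^*$ for all $A\in\mathcal{H}_n$. -/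

import Mathlib

open scoped ComplexOrder Matrix

/-- The real vector space of `n × n` complex Hermitian matrices. -/
abbrev HermitianMatrices (n : ℕ) : Type :=
  selfAdjoint (Matrix (Fin n) (Fin n) ℂ)

/-- The set of positive definite matrices, as a subset of the space of Hermitian matrices. -/
def positiveDefiniteMatrices (n : ℕ) : Set (HermitianMatrices n) :=
  {A | (A : Matrix (Fin n) (Fin n) ℂ).PosDef}

open Matrix

/-! Positive definite matrices span `HermitianMatrices n`, so a map with the stated image property
is bijective. By closure it preserves positive semidefiniteness both ways, hence the extreme rays of
that cone, so each `x x*` goes to some `y y*` (`exists_map_rankOne_eq_vecMulVec`).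
`exists_congruence` needs only this and invertibility of `F 1`. A congruence makes `F` fix every
`E_ii` and the all-ones matrix. Polarization then shows that the `(i, j)` entry of `F A` depends
only on that of `A`, through a real-linear isometry of `ℂ` fixing `1`: identity or conjugation. The
choice is the same for all pairs (`map_crossTerm_I_congr`, `map_crossTerm_I_comm`), giving `A` or
its transpose. -/

/-- The Hermitian matrix `x y* + y x*`. -/
def crossTerm {n : ℕ} (x y : Fin n → ℂ) : HermitianMatrices n :=
  ⟨vecMulVec x (star y) + vecMulVec y (star x), by
    rw [selfAdjoint.mem_iff, star_eq_conjTranspose, conjTranspose_add, conjTranspose_vecMulVec,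
      conjTranspose_vecMulVec, star_star, star_star, add_comm]⟩

/-- The Hermitian matrix `x x*`. -/
def rankOne {n : ℕ} (x : Fin n → ℂ) : HermitianMatrices n :=
  ⟨vecMulVec x (star x), by
    rw [selfAdjoint.mem_iff, star_eq_conjTranspose, conjTranspose_vecMulVec, star_star]⟩

/-! ### Polarization identities for rank-one matrices -/

section Polarization

variable {n : ℕ}

theorem coe_rankOne (x : Fin n → ℂ) :
    (rankOne x : Matrix (Fin n) (Fin n) ℂ) = vecMulVec x (star x) := rfl

theorem coe_crossTerm (x y : Fin n → ℂ) :
    (crossTerm x y : Matrix (Fin n) (Fin n) ℂ) =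
      vecMulVec x (star y) + vecMulVec y (star x) := rfl

theorem rankOne_add (x y : Fin n → ℂ) :
    rankOne (x + y) = rankOne x + rankOne y + crossTerm x y := by
  apply Subtype.ext
  ext i j
  simp [coe_rankOne, coe_crossTerm, vecMulVec_apply]
  ring

theorem rankOne_smul (c : ℂ) (x : Fin n → ℂ) :
    rankOne (c • x) = Complex.normSq c • rankOne x := by
  apply Subtype.ext
  ext i j
  simp [coe_rankOne, vecMulVec_apply, Complex.normSq_eq_conj_mul_self]
  ring

theorem crossTerm_comm (x y : Fin n → ℂ) : crossTerm x y = crossTerm y x :=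
  Subtype.ext (add_comm _ _)

theorem crossTerm_add_right (x y z : Fin n → ℂ) :
    crossTerm x (y + z) = crossTerm x y + crossTerm x z := by
  apply Subtype.ext
  ext i j
  simp [coe_crossTerm, vecMulVec_apply]
  ring

theorem crossTerm_smul_right (r : ℝ) (x y : Fin n → ℂ) :
    crossTerm x ((r : ℂ) • y) = r • crossTerm x y := by
  apply Subtype.ext
  ext i j
  simp [coe_crossTerm, vecMulVec_apply]

theorem crossTerm_smul_left (c : ℂ) (x y : Fin n → ℂ) :
    crossTerm (c • x) y = crossTerm x (star c • y) := by
  apply Subtype.ext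
  ext i j
  simp [coe_crossTerm, vecMulVec_apply]

theorem crossTerm_neg_right (x y : Fin n → ℂ) : crossTerm x (-y) = -crossTerm x y := by
  apply Subtype.ext
  ext i j
  simp [coe_crossTerm, vecMulVec_apply]
  ring

theorem crossTerm_smul_self (c : ℂ) (x : Fin n → ℂ) :
    crossTerm x (c • x) = (2 * c.re) • rankOne x := by
  apply Subtype.ext
  ext i j
  have h : (c.re : ℂ) * 2 = c + star c := by
    simp [Complex.ext_iff]; ring
  simp only [coe_crossTerm, coe_rankOne, selfAdjoint.val_smul, Matrix.add_apply, Matrix.smul_apply,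
    vecMulVec_apply, Pi.smul_apply, Pi.star_apply, smul_eq_mul, Complex.real_smul, star_mul]
  push_cast
  linear_combination (-(x i * star (x j))) * h

theorem rankOne_smul_add_inv_smul {r : ℝ} (hr : r ≠ 0) (x y : Fin n → ℂ) :
    rankOne ((r : ℂ) • x + ((r⁻¹ : ℝ) : ℂ) • y) =
      r ^ 2 • rankOne x + (r⁻¹) ^ 2 • rankOne y + crossTerm x y := by
  rw [rankOne_add, rankOne_smul, rankOne_smul, crossTerm_smul_left, crossTerm_comm x]
  rw [show star (r : ℂ) = r from Complex.conj_ofReal r, smul_smul, ← Complex.ofReal_mul,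
    mul_inv_cancel₀ hr, Complex.ofReal_one, one_smul, Complex.normSq_ofReal, Complex.normSq_ofReal,
    crossTerm_comm, ← sq, ← sq]

/-- The pairs `(i, j)` and `(j, i)` give the same term, hence the factor `1 / 2`; the `star` undoes
the conjugation in the second argument of `crossTerm`. -/
theorem hermitian_eq_sum_crossTerm (A : HermitianMatrices n) :
    A = (1 / 2 : ℝ) • ∑ p : Fin n × Fin n,
      crossTerm (Pi.single p.1 1) (star ((A : Matrix (Fin n) (Fin n) ℂ) p.1 p.2) •
        Pi.single p.2 1) := by
  apply Subtype.ext
  ext k l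
  have hA : star ((A : Matrix (Fin n) (Fin n) ℂ) l k) = (A : Matrix (Fin n) (Fin n) ℂ) k l :=
    congrFun (congrFun A.2 k) l
  rw [selfAdjoint.val_smul, AddSubgroup.val_finsetSum, Matrix.smul_apply, Matrix.sum_apply,
    Fintype.sum_prod_type]
  have h : ∀ i j, (crossTerm (Pi.single i 1) (star ((A : Matrix (Fin n) (Fin n) ℂ) i j) •
        Pi.single j 1) : Matrix (Fin n) (Fin n) ℂ) k l =
      (if k = i then if l = j then (A : Matrix (Fin n) (Fin n) ℂ) i j else 0 else 0) +
      (if l = i then if k = j then star ((A : Matrix (Fin n) (Fin n) ℂ) i j) else 0 else 0) := by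
    intro i j
    simp only [coe_crossTerm, Matrix.add_apply, vecMulVec_apply, Pi.smul_apply, Pi.star_apply,
      Pi.single_apply]
    split_ifs <;> simp
  simp only [h, Finset.sum_add_distrib]
  simp
  have := hA
  simp at this
  rw [this]
  ring

end Polarization

/-! ### Maps fixing the diagonal units: entries decouple -/

section Normalized

variable {n : ℕ} {F : HermitianMatrices n →ₗ[ℝ] Matrix (Fin n) (Fin n) ℂ}

/-- The free weight `r` rescales the two diagonal terms without changing the cross term. -/
theorem map_crossTerm_add (hF : ∀ x, ∃ y, F (rankOne x) = vecMulVec y (star y))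
    (hd : ∀ i, F (rankOne (Pi.single i 1)) = single i i 1) (i j : Fin n) (c : ℂ) {r : ℝ}
    (hr : r ≠ 0) :
    ∃ y : Fin n → ℂ, ∀ k l, y k * star (y l) =
      (r ^ 2 : ℝ) * single i i (1 : ℂ) k l +
        ((r⁻¹) ^ 2 * Complex.normSq c : ℝ) * single j j (1 : ℂ) k l +
        F (crossTerm (Pi.single i 1) (c • Pi.single j 1)) k l := by
  obtain ⟨y, hy⟩ := hF ((r : ℂ) • Pi.single i 1 + ((r⁻¹ : ℝ) : ℂ) • (c • Pi.single j 1))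
  refine ⟨y, fun k l => ?_⟩
  have h := congrFun (congrFun hy k) l
  rw [rankOne_smul_add_inv_smul hr, rankOne_smul, map_add, map_add, map_smul, map_smul, map_smul,
    hd, hd, smul_smul, vecMulVec_apply] at h
  exact h.symm

/-- Diagonal entries of `y y*` are nonnegative; using `c` and `-c` bounds the entry by the two
diagonal terms. As `i ≠ j`, at most one is nonzero at `k`, and a suitable `r` makes it arbitrarily
small. -/
theorem map_crossTerm_diag (hF : ∀ x, ∃ y, F (rankOne x) = vecMulVec y (star y))
    (hd : ∀ i, F (rankOne (Pi.single i 1)) = single i i 1) {i j : Fin n} (hij : i ≠ j) (c : ℂ)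
    (k : Fin n) : F (crossTerm (Pi.single i 1) (c • Pi.single j 1)) k k = 0 := by
  have key : ∀ c : ℂ, ∀ r : ℝ, r ≠ 0 →
      0 ≤ r ^ 2 * (if i = k then 1 else 0) + (r⁻¹) ^ 2 * Complex.normSq c * (if j = k then 1 else 0)
        + (F (crossTerm (Pi.single i 1) (c • Pi.single j 1)) k k).re ∧
      (F (crossTerm (Pi.single i 1) (c • Pi.single j 1)) k k).im = 0 := by
    intro c r hr
    obtain ⟨y, hy⟩ := map_crossTerm_add hF hd i j c hr
    have h := hy k k
    rw [show star (y k) = (starRingEnd ℂ) (y k) from rfl, Complex.mul_conj] at h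
    simp only [single_apply, and_self] at h
    have hre := congrArg Complex.re h
    have him := congrArg Complex.im h
    constructor
    · have := Complex.normSq_nonneg (y k)
      rw [Complex.ofReal_re] at hre
      rw [hre] at this
      convert this using 1
      simp only [Complex.add_re, Complex.re_ofReal_mul]
      split_ifs <;> simp
    · rw [Complex.ofReal_im] at him
      simp only [Complex.add_im, Complex.im_ofReal_mul] at him
      have h0 : ∀ p : Prop, [Decidable p] → (if p then (1 : ℂ) else 0).im = 0 := by
        intro p _; split_ifs <;> simp
      rw [h0, h0] at him
      linarith
  refine Complex.ext ?_ (key c 1 one_ne_zero).2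
  have key' : ∀ r : ℝ, r ≠ 0 →
      |(F (crossTerm (Pi.single i 1) (c • Pi.single j 1)) k k).re| ≤ r ^ 2 * (if i = k then 1 else 0)
        + (r⁻¹) ^ 2 * Complex.normSq c * (if j = k then 1 else 0) := by
    intro r hr
    have h1 := (key c r hr).1
    have h2 := (key (-c) r hr).1
    rw [neg_smul, crossTerm_neg_right, map_neg F, Complex.normSq_neg, Matrix.neg_apply,
      Complex.neg_re] at h2
    rw [abs_le]
    constructor <;> linarith
  rw [Complex.zero_re]
  by_contra h0
  set t := |(F (crossTerm (Pi.single i 1) (c • Pi.single j 1)) k k).re| with ht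
  have htpos : 0 < t := abs_pos.mpr h0
  by_cases hik : i = k
  · have hjk : j ≠ k := fun h => hij (hik.trans h.symm)
    simp only [hik, hjk, if_true, if_false, mul_zero, add_zero, mul_one] at key'
    have h := key' (√(t / 2)) (by positivity)
    rw [Real.sq_sqrt (by positivity)] at h
    linarith
  · simp only [hik, if_false, mul_zero, zero_add] at key'
    by_cases hjk : j = k
    · simp only [hjk, if_true, mul_one] at key'
      have hs : 0 ≤ Complex.normSq c := Complex.normSq_nonneg c
      -- The bound becomes `t * |c|² / (|c|² + 1) < t`; the `+ 1` also covers `c = 0`.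
      have h := key' (√((Complex.normSq c + 1) / t)) (by positivity)
      rw [inv_pow, Real.sq_sqrt (by positivity), inv_div, div_mul_eq_mul_div,
        le_div_iff₀ (by positivity)] at h
      linarith
    · simp only [hjk, if_false, mul_zero] at key'
      exact absurd (key' 1 one_ne_zero) (not_le.mpr htpos)

theorem map_crossTerm_eq_zero (hF : ∀ x, ∃ y, F (rankOne x) = vecMulVec y (star y))
    (hd : ∀ i, F (rankOne (Pi.single i 1)) = single i i 1) {i j k l : Fin n} (c : ℂ)
    (h₁ : (i, j) ≠ (k, l)) (h₂ : (i, j) ≠ (l, k)) :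
    F (crossTerm (Pi.single i 1) (c • Pi.single j 1)) k l = 0 := by
  rcases eq_or_ne i j with rfl | hij
  · rw [crossTerm_smul_self, map_smul, hd, Matrix.smul_apply, single_apply_of_ne, smul_zero]
    rintro ⟨rfl, rfl⟩
    exact h₁ rfl
  rcases eq_or_ne k l with rfl | hkl
  · exact map_crossTerm_diag hF hd hij c k
  obtain ⟨y, hy⟩ := map_crossTerm_add hF hd i j c one_ne_zero
  -- A zero diagonal entry `|y m|²` kills a whole row and column of `y y*`.
  have hz : ∀ m, i ≠ m → j ≠ m → y m = 0 := by
    intro m hi hj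
    have h := hy m m
    rw [map_crossTerm_diag hF hd hij, single_apply_of_ne _ _ _ _ _ (by tauto),
      single_apply_of_ne _ _ _ _ _ (by tauto)] at h
    simpa using h
  have h := hy k l
  rw [single_apply_of_ne _ _ _ _ _ (by rintro ⟨rfl, rfl⟩; exact hkl rfl),
    single_apply_of_ne _ _ _ _ _ (by rintro ⟨rfl, rfl⟩; exact hkl rfl), mul_zero, mul_zero,
    zero_add, zero_add] at h
  rw [← h]
  have : (i ≠ k ∧ j ≠ k) ∨ (i ≠ l ∧ j ≠ l) := by
    by_contra hc
    grind
  rcases this with ⟨h1, h2⟩ | ⟨h1, h2⟩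
  · rw [hz k h1 h2, zero_mul]
  · rw [hz l h1 h2, star_zero, mul_zero]

theorem normSq_map_crossTerm (hF : ∀ x, ∃ y, F (rankOne x) = vecMulVec y (star y))
    (hd : ∀ i, F (rankOne (Pi.single i 1)) = single i i 1) {i j : Fin n} (hij : i ≠ j) (c : ℂ) :
    Complex.normSq (F (crossTerm (Pi.single i 1) (c • Pi.single j 1)) i j) = Complex.normSq c := by
  obtain ⟨y, hy⟩ := map_crossTerm_add hF hd i j c one_ne_zero
  have hii := hy i i
  have hjj := hy j j
  have h := hy i j
  rw [map_crossTerm_diag hF hd hij] at hii hjj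
  simp only [single_apply, hij, hij.symm, and_self, and_false, false_and, if_true, if_false] at *
  rw [show ∀ k, star (y k) = (starRingEnd ℂ) (y k) from fun _ => rfl, Complex.mul_conj] at hii hjj
  have h1 : Complex.normSq (y i) = 1 := by exact_mod_cast (by simpa using hii)
  have h2 : Complex.normSq (y j) = Complex.normSq c := by exact_mod_cast (by simpa using hjj)
  have h3 := congrArg Complex.normSq h
  rw [Complex.normSq_mul, show star (y j) = (starRingEnd ℂ) (y j) from rfl,
    Complex.normSq_conj, h1, h2] at h3
  simpa using h3.symm

theorem map_diag (hF : ∀ x, ∃ y, F (rankOne x) = vecMulVec y (star y))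
    (hd : ∀ i, F (rankOne (Pi.single i 1)) = single i i 1) (A : HermitianMatrices n) (k : Fin n) :
    F A k k = (A : Matrix (Fin n) (Fin n) ℂ) k k := by
  conv_lhs => rw [hermitian_eq_sum_crossTerm A]
  rw [map_smul, map_sum, Matrix.smul_apply, Matrix.sum_apply,
    Finset.sum_eq_single_of_mem (k, k) (Finset.mem_univ _)
      (fun p _ hp => map_crossTerm_eq_zero hF hd _ hp hp),
    crossTerm_smul_self, map_smul, hd, Matrix.smul_apply, single_apply_same]
  have hA : star ((A : Matrix (Fin n) (Fin n) ℂ) k k) = (A : Matrix (Fin n) (Fin n) ℂ) k k :=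
    congrFun (congrFun A.2 k) k
  rw [hA, smul_smul, Complex.real_smul, mul_one]
  have := Complex.conj_eq_iff_re.mp hA
  push_cast
  rw [this]
  ring

theorem map_offDiag (hF : ∀ x, ∃ y, F (rankOne x) = vecMulVec y (star y))
    (hd : ∀ i, F (rankOne (Pi.single i 1)) = single i i 1) (A : HermitianMatrices n)
    {k l : Fin n} (hkl : k ≠ l) :
    F A k l = F (crossTerm (Pi.single k 1)
      (star ((A : Matrix (Fin n) (Fin n) ℂ) k l) • Pi.single l 1)) k l := by
  conv_lhs => rw [hermitian_eq_sum_crossTerm A]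
  rw [map_smul, map_sum, Matrix.smul_apply, Matrix.sum_apply,
    ← Finset.sum_subset (Finset.subset_univ {(k, l), (l, k)}), Finset.sum_pair]
  · have hA : star ((A : Matrix (Fin n) (Fin n) ℂ) l k) = (A : Matrix (Fin n) (Fin n) ℂ) k l :=
      congrFun (congrFun A.2 k) l
    simp only
    rw [crossTerm_comm (Pi.single l 1), crossTerm_smul_left, hA, Complex.real_smul]
    push_cast
    ring
  · simp [hkl]
  · intro p _ hp
    simp only [Finset.mem_insert, Finset.mem_singleton, not_or] at hp
    exact map_crossTerm_eq_zero hF hd _ hp.1 hp.2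

end Normalized

/-! ### Identity or conjugation, uniformly over all entries -/

section Normalized

variable {n : ℕ} {F : HermitianMatrices n →ₗ[ℝ] Matrix (Fin n) (Fin n) ℂ}

theorem map_crossTerm_one (hF : ∀ x, ∃ y, F (rankOne x) = vecMulVec y (star y))
    (hd : ∀ i, F (rankOne (Pi.single i 1)) = single i i 1)
    (h1 : F (rankOne 1) = vecMulVec 1 (star 1)) {i j : Fin n} (hij : i ≠ j) :
    F (crossTerm (Pi.single i 1) (Pi.single j 1)) i j = 1 := by
  have h := map_offDiag hF hd (rankOne 1) hij
  rw [h1] at h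
  simpa [coe_rankOne, vecMulVec_apply] using h.symm

/-- The off-diagonal entry at `I` is purely imaginary of modulus one. -/
theorem map_crossTerm_I (hF : ∀ x, ∃ y, F (rankOne x) = vecMulVec y (star y))
    (hd : ∀ i, F (rankOne (Pi.single i 1)) = single i i 1)
    (h1 : F (rankOne 1) = vecMulVec 1 (star 1)) {i j : Fin n} (hij : i ≠ j) :
    F (crossTerm (Pi.single i 1) (-Complex.I • Pi.single j 1)) i j = Complex.I ∨
      F (crossTerm (Pi.single i 1) (-Complex.I • Pi.single j 1)) i j = -Complex.I := by
  have hI := normSq_map_crossTerm hF hd hij (-Complex.I)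
  -- `|z| = 1` and `|1 + z|² = 2` force `z = ±I`.
  have hI1 := normSq_map_crossTerm hF hd hij (1 + -Complex.I)
  rw [add_smul, one_smul, crossTerm_add_right, map_add, Matrix.add_apply,
    map_crossTerm_one hF hd h1 hij] at hI1
  generalize F (crossTerm (Pi.single i 1) (-Complex.I • Pi.single j 1)) i j = z at *
  simp [Complex.normSq_apply] at hI hI1
  have hre : z.re = 0 := by linarith
  rw [hre] at hI
  have him : z.im = 1 ∨ z.im = -1 := by
    rw [← mul_self_eq_one_iff]; linarith
  rcases him with h | h
  · left; apply Complex.ext <;> simp [hre, h]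
  · right; apply Complex.ext <;> simp [hre, h]

theorem map_offDiag_eq (hF : ∀ x, ∃ y, F (rankOne x) = vecMulVec y (star y))
    (hd : ∀ i, F (rankOne (Pi.single i 1)) = single i i 1)
    (h1 : F (rankOne 1) = vecMulVec 1 (star 1)) (A : HermitianMatrices n)
    {i j : Fin n} (hij : i ≠ j) :
    F A i j = ((A : Matrix (Fin n) (Fin n) ℂ) i j).re + ((A : Matrix (Fin n) (Fin n) ℂ) i j).im *
      F (crossTerm (Pi.single i 1) (-Complex.I • Pi.single j 1)) i j := by
  rw [map_offDiag hF hd A hij]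
  generalize (A : Matrix (Fin n) (Fin n) ℂ) i j = a
  have ha : star a • (Pi.single j 1 : Fin n → ℂ) = (a.re : ℂ) • Pi.single j 1 +
      (a.im : ℂ) • (-Complex.I • Pi.single j 1) := by
    rw [smul_smul, ← add_smul]
    congr 1
    apply Complex.ext <;> simp
  rw [ha, crossTerm_add_right, crossTerm_smul_right, crossTerm_smul_right, map_add, map_smul,
    map_smul, Matrix.add_apply, Matrix.smul_apply, Matrix.smul_apply,
    map_crossTerm_one hF hd h1 hij, Complex.real_smul, Complex.real_smul, mul_one]

theorem map_crossTerm_I_comm (hF : ∀ x, ∃ y, F (rankOne x) = vecMulVec y (star y))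
    (hd : ∀ i, F (rankOne (Pi.single i 1)) = single i i 1)
    (h1 : F (rankOne 1) = vecMulVec 1 (star 1)) {i j : Fin n} (hij : i ≠ j) :
    F (crossTerm (Pi.single i 1) (-Complex.I • Pi.single j 1)) i j =
      F (crossTerm (Pi.single j 1) (-Complex.I • Pi.single i 1)) j i := by
  obtain ⟨y, hy⟩ := map_crossTerm_add hF hd i j (-Complex.I) one_ne_zero
  have hij' := hy i j
  have hji := hy j i
  rw [crossTerm_comm, crossTerm_smul_left, star_neg, show star Complex.I = -Complex.I from
    Complex.conj_I, neg_neg, ← neg_neg Complex.I, neg_smul, crossTerm_neg_right, map_neg F,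
    Matrix.neg_apply, neg_neg] at hji
  simp only [single_apply, hij, hij.symm, and_false, false_and, if_false,
    mul_zero, zero_add] at hij' hji
  have h : star (F (crossTerm (Pi.single i 1) (-Complex.I • Pi.single j 1)) i j) =
      -F (crossTerm (Pi.single j 1) (-Complex.I • Pi.single i 1)) j i := by
    rw [← hij', ← hji, star_mul, star_star]
  rcases map_crossTerm_I hF hd h1 hij with h' | h' <;> rw [h'] at h ⊢
  · simpa using h
  · simpa [neg_eq_iff_eq_neg] using h

/-- Test on `x` with `I` in place `i` and `1` elsewhere: the image `y y*` has `y j * star (y k) = 1`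
and `|y j| = 1`, so `y j = y k` and the entries `(i, j)`, `(i, k)` agree. -/
theorem map_crossTerm_I_congr (hF : ∀ x, ∃ y, F (rankOne x) = vecMulVec y (star y))
    (hd : ∀ i, F (rankOne (Pi.single i 1)) = single i i 1)
    (h1 : F (rankOne 1) = vecMulVec 1 (star 1)) {i j k : Fin n} (hij : i ≠ j) (hik : i ≠ k) :
    F (crossTerm (Pi.single i 1) (-Complex.I • Pi.single j 1)) i j =
      F (crossTerm (Pi.single i 1) (-Complex.I • Pi.single k 1)) i k := by
  rcases eq_or_ne j k with rfl | hjk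
  · rfl
  set x : Fin n → ℂ := Function.update 1 i Complex.I with hx
  obtain ⟨y, hy⟩ := hF x
  have e : ∀ k l, F (rankOne x) k l = y k * star (y l) := fun k l =>
    congrFun (congrFun hy k) l
  have exi : x i = Complex.I := by simp [hx]
  have exj : x j = 1 := by simp [hx, hij.symm]
  have exk : x k = 1 := by simp [hx, hik.symm]
  have ejj := map_diag hF hd (rankOne x) j
  have eij := map_offDiag_eq hF hd h1 (rankOne x) hij
  have eik := map_offDiag_eq hF hd h1 (rankOne x) hik
  have ejk := map_offDiag_eq hF hd h1 (rankOne x) hjk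
  rw [e] at ejj eij eik ejk
  simp only [coe_rankOne, vecMulVec_apply, Pi.star_apply, exi, exj, exk, star_one, mul_one,
    Complex.I_re, Complex.I_im, Complex.one_re, Complex.one_im, Complex.ofReal_zero,
    Complex.ofReal_one, zero_add, one_mul, zero_mul, add_zero] at ejj eij eik ejk
  rw [← eij, ← eik]
  linear_combination (y i * star (y k)) * ejj - (y i * star (y j)) * ejk

theorem eq_self_or_transpose (hF : ∀ x, ∃ y, F (rankOne x) = vecMulVec y (star y))
    (hd : ∀ i, F (rankOne (Pi.single i 1)) = single i i 1)
    (h1 : F (rankOne 1) = vecMulVec 1 (star 1)) :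
    (∀ A : HermitianMatrices n, F A = A) ∨
      (∀ A : HermitianMatrices n, F A = (A : Matrix (Fin n) (Fin n) ℂ)ᵀ) := by
  by_cases h : ∀ i j, i ≠ j →
      F (crossTerm (Pi.single i 1) (-Complex.I • Pi.single j 1)) i j = Complex.I
  · left
    intro A
    ext i j
    rcases eq_or_ne i j with rfl | hij
    · exact map_diag hF hd A i
    · rw [map_offDiag_eq hF hd h1 A hij, h i j hij, Complex.re_add_im]
  · right
    push Not at h
    obtain ⟨i₀, j₀, h₀, hne⟩ := h
    have hneg := (map_crossTerm_I hF hd h1 h₀).resolve_left hne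
    have hall : ∀ i j, i ≠ j →
        F (crossTerm (Pi.single i 1) (-Complex.I • Pi.single j 1)) i j = -Complex.I := by
      intro i j hij
      refine Eq.trans ?_ hneg
      rcases eq_or_ne i i₀ with rfl | hi
      · exact map_crossTerm_I_congr hF hd h1 hij h₀
      -- The sign travels `(i, j)` → `(i, i₀)` → `(i₀, i)` → `(i₀, j₀)`.
      · rw [map_crossTerm_I_congr hF hd h1 hij hi, map_crossTerm_I_comm hF hd h1 hi,
          map_crossTerm_I_congr hF hd h1 hi.symm h₀]
    intro A
    ext i j
    rcases eq_or_ne i j with rfl | hij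
    · rw [map_diag hF hd A i, transpose_apply]
    · have hA : star ((A : Matrix (Fin n) (Fin n) ℂ) i j) = (A : Matrix (Fin n) (Fin n) ℂ) j i :=
        congrFun (congrFun A.2 j) i
      rw [map_offDiag_eq hF hd h1 A hij, hall i j hij, transpose_apply, ← hA]
      apply Complex.ext <;> simp

end Normalized

/-! ### Reduction to the normalized case by congruence -/

section RankOnePreservers

variable {n : ℕ}

theorem mul_vecMulVec_star_mul_conjTranspose (S : Matrix (Fin n) (Fin n) ℂ) (y : Fin n → ℂ) :
    S * vecMulVec y (star y) * Sᴴ = vecMulVec (S *ᵥ y) (star (S *ᵥ y)) := by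
  rw [mul_vecMulVec, vecMulVec_mul, star_mulVec]

theorem coe_rankOne_single (i : Fin n) :
    (rankOne (Pi.single i 1) : Matrix (Fin n) (Fin n) ℂ) = single i i 1 := by
  rw [single_eq_single_vecMulVec_single, coe_rankOne, Pi.star_single, star_one]

theorem sum_rankOne_single : ∑ i : Fin n, rankOne (Pi.single i 1) = 1 := by
  apply Subtype.ext
  rw [AddSubgroup.val_finsetSum]
  simp only [coe_rankOne_single]
  exact sum_single_one

/-- The map `A ↦ S F(A) S*`. -/
noncomputable def conjMap (S : Matrix (Fin n) (Fin n) ℂ)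
    (F : HermitianMatrices n →ₗ[ℝ] Matrix (Fin n) (Fin n) ℂ) :
    HermitianMatrices n →ₗ[ℝ] Matrix (Fin n) (Fin n) ℂ :=
  LinearMap.mulRight ℝ Sᴴ ∘ₗ LinearMap.mulLeft ℝ S ∘ₗ F

theorem conjMap_apply (S : Matrix (Fin n) (Fin n) ℂ)
    (F : HermitianMatrices n →ₗ[ℝ] Matrix (Fin n) (Fin n) ℂ) (A : HermitianMatrices n) :
    conjMap S F A = S * F A * Sᴴ := rfl

/-- A real linear map from the Hermitian matrices taking rank-one positive semidefinite matrices
to matrices `y y*` and the identity to an invertible matrix is a congruence, possibly composed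
with the transpose. -/
theorem exists_congruence {F : HermitianMatrices n →ₗ[ℝ] Matrix (Fin n) (Fin n) ℂ}
    (hF : ∀ x, ∃ y, F (rankOne x) = vecMulVec y (star y)) (hu : IsUnit (F 1)) :
    ∃ R : Matrix (Fin n) (Fin n) ℂ, IsUnit R ∧
      ((∀ A : HermitianMatrices n, F A = R * (A : Matrix (Fin n) (Fin n) ℂ) * Rᴴ) ∨
        (∀ A : HermitianMatrices n, F A = R * (A : Matrix (Fin n) (Fin n) ℂ)ᵀ * Rᴴ)) := by
  choose y hy using hF
  set Y : Matrix (Fin n) (Fin n) ℂ := of fun k i => y (Pi.single i 1) k with hYdef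
  have hYcol : ∀ i, Y *ᵥ Pi.single i 1 = y (Pi.single i 1) := by
    intro i
    ext k
    simp [hYdef]
  -- The columns of `Y` are the vectors `y (e_i)`, so `Y` inherits invertibility from `F 1`.
  have hYY : Y * Yᴴ = F 1 := by
    rw [← sum_rankOne_single, map_sum]
    simp only [hy]
    ext k l
    simp [mul_apply, Matrix.sum_apply, vecMulVec_apply, hYdef]
  have hY : IsUnit Y := by
    rw [isUnit_iff_isUnit_det] at hu ⊢
    rw [← hYY, det_mul] at hu
    exact isUnit_of_mul_isUnit_left hu
  obtain ⟨Z, hYZ, hZY⟩ : ∃ Z, Y * Z = 1 ∧ Z * Y = 1 :=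
    ⟨_, mul_nonsing_inv _ ((isUnit_iff_isUnit_det _).mp hY),
      nonsing_inv_mul _ ((isUnit_iff_isUnit_det _).mp hY)⟩
  set G := conjMap Z F with hG
  have hGr : ∀ x, G (rankOne x) = vecMulVec (Z *ᵥ y x) (star (Z *ᵥ y x)) := fun x => by
    rw [hG, conjMap_apply, hy, mul_vecMulVec_star_mul_conjTranspose]
  have hGd : ∀ i, G (rankOne (Pi.single i 1)) = single i i 1 := fun i => by
    rw [hGr, ← hYcol, mulVec_mulVec, hZY, one_mulVec, ← coe_rankOne, coe_rankOne_single]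
  set z := Z *ᵥ y 1 with hz
  have hz1 : ∀ i, z i * star (z i) = 1 := fun i => by
    have h := map_diag (fun x => ⟨_, hGr x⟩) hGd (rankOne 1) i
    rw [hGr, vecMulVec_apply] at h
    simpa [coe_rankOne, vecMulVec_apply] using h
  have hDD : diagonal z * diagonal (star z) = 1 := by
    rw [diagonal_mul_diagonal, ← diagonal_one]
    congr 1
    exact funext hz1
  have hDD' : diagonal (star z) * diagonal z = 1 := mul_eq_one_comm.mp hDD
  -- This diagonal unitary keeps each `E_ii` and turns `z z*` into the all-ones matrix.
  set H := conjMap (diagonal (star z)) G with hH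
  have hHr : ∀ x, ∃ w, H (rankOne x) = vecMulVec w (star w) := fun x =>
    ⟨_, by rw [hH, conjMap_apply, hGr, mul_vecMulVec_star_mul_conjTranspose]⟩
  have hHd : ∀ i, H (rankOne (Pi.single i 1)) = single i i 1 := fun i => by
    rw [hH, conjMap_apply, hGd, diagonal_conjTranspose, star_star, ← coe_rankOne_single]
    ext k l
    rw [mul_diagonal, diagonal_mul, coe_rankOne_single, single_apply]
    split_ifs with h
    · rw [← h.1, ← h.2, mul_one, mul_comm]
      exact hz1 i
    · simp
  have hH1 : H (rankOne 1) = vecMulVec 1 (star 1) := by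
    rw [hH, conjMap_apply, hGr, mul_vecMulVec_star_mul_conjTranspose]
    have : diagonal (star z) *ᵥ z = 1 := by
      ext i
      rw [mulVec_diagonal, mul_comm]
      exact hz1 i
    rw [this]
  have hFH : ∀ A, F A = (Y * diagonal z) * H A * (Y * diagonal z)ᴴ := fun A => by
    have h1 : Y * diagonal z * diagonal (star z) * Z = 1 := by
      rw [mul_assoc Y, hDD, mul_one, hYZ]
    calc F A = (Y * diagonal z * diagonal (star z) * Z) * F A *
          (Y * diagonal z * diagonal (star z) * Z)ᴴ := by
            rw [h1, conjTranspose_one, one_mul, mul_one]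
      _ = _ := by
        rw [hH, hG, conjMap_apply, conjMap_apply]
        simp only [conjTranspose_mul, mul_assoc]
  refine ⟨Y * diagonal z, hY.mul (IsUnit.of_mul_eq_one _ hDD), ?_⟩
  rcases eq_self_or_transpose hHr hHd hH1 with h | h
  · exact Or.inl fun A => by rw [hFH, h]
  · exact Or.inr fun A => by rw [hFH, h]

end RankOnePreservers
-- Extreme rays of the positive semidefinite cone
section PositiveCone

variable {n : ℕ}

theorem posSemidef_of_forall_add_smul {A B : HermitianMatrices n}
    (h : ∀ ε : ℝ, 0 < ε → ((A + ε • B : HermitianMatrices n) : Matrix (Fin n) (Fin n) ℂ).PosSemidef) :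
    (A : Matrix (Fin n) (Fin n) ℂ).PosSemidef := by
  refine .of_dotProduct_mulVec_nonneg A.2 fun x => ?_
  have h' : ∀ ε : ℝ, 0 < ε →
      0 ≤ star x ⬝ᵥ (A : Matrix (Fin n) (Fin n) ℂ) *ᵥ x +
        (ε : ℂ) * (star x ⬝ᵥ (B : Matrix (Fin n) (Fin n) ℂ) *ᵥ x) := by
    intro ε hε
    have := (h ε hε).dotProduct_mulVec_nonneg x
    rwa [AddSubgroup.coe_add, selfAdjoint.val_smul, add_mulVec, smul_mulVec, dotProduct_add,
      dotProduct_smul, Complex.real_smul] at this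
  generalize star x ⬝ᵥ (A : Matrix (Fin n) (Fin n) ℂ) *ᵥ x = a at h'
  generalize star x ⬝ᵥ (B : Matrix (Fin n) (Fin n) ℂ) *ᵥ x = b at h'
  simp only [Complex.le_def, Complex.zero_re, Complex.zero_im, Complex.add_re, Complex.add_im,
    Complex.re_ofReal_mul, Complex.im_ofReal_mul] at h' ⊢
  refine ⟨?_, by linarith [(h' 1 one_pos).2, (h' 2 two_pos).2]⟩
  by_contra! ha
  have hb : 0 < |b.re| + 1 := by positivity
  -- With this `ε`, `ε * b.re ≤ -a.re / 2`, so the form stays negative.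
  have hε : 0 < -a.re / (2 * (|b.re| + 1)) := div_pos (by linarith) (by positivity)
  have h1 := (h' _ hε).1
  have h2 : -a.re / (2 * (|b.re| + 1)) * b.re ≤ -a.re / (2 * (|b.re| + 1)) * (|b.re| + 1) :=
    mul_le_mul_of_nonneg_left (by linarith [le_abs_self b.re]) hε.le
  have h3 : -a.re / (2 * (|b.re| + 1)) * (|b.re| + 1) = -a.re / 2 := by
    field_simp
  linarith

/-- Domination by `x x*` makes `B` vanish on the orthogonal complement of `x`; being Hermitian, it
is then a real multiple of `x x*`. -/
theorem exists_eq_smul_of_le_vecMulVec {x : Fin n → ℂ} {B : Matrix (Fin n) (Fin n) ℂ}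
    (hB : B.PosSemidef) (h : (vecMulVec x (star x) - B).PosSemidef) :
    ∃ t : ℝ, B = t • vecMulVec x (star x) := by
  have hker : ∀ v, star x ⬝ᵥ v = 0 → B *ᵥ v = 0 := by
    intro v hv
    rw [← hB.dotProduct_mulVec_zero_iff]
    have h1 := h.dotProduct_mulVec_nonneg v
    rw [sub_mulVec, vecMulVec_mulVec, hv, MulOpposite.op_zero, zero_smul, zero_sub,
      dotProduct_neg] at h1
    exact le_antisymm (neg_nonneg.mp h1) (hB.dotProduct_mulVec_nonneg v)
  by_cases hx : x = 0
  · refine ⟨0, ?_⟩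
    rw [zero_smul]
    refine ext_of_mulVec_single fun i => ?_
    rw [hker _ (by simp [hx]), zero_mulVec]
  have hs : star x ⬝ᵥ x ≠ 0 := by simpa [dotProduct_star_self_eq_zero] using hx
  have hBv : ∀ v, (star x ⬝ᵥ x) • B *ᵥ v = (star x ⬝ᵥ v) • B *ᵥ x := by
    intro v
    have h1 := hker ((star x ⬝ᵥ x) • v - (star x ⬝ᵥ v) • x) (by
      rw [dotProduct_sub, dotProduct_smul, dotProduct_smul, smul_eq_mul, smul_eq_mul, mul_comm,
        sub_self])
    rwa [mulVec_sub, mulVec_smul, mulVec_smul, sub_eq_zero] at h1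
  have hBe : ∀ i j, (star x ⬝ᵥ x) * B i j = (B *ᵥ x) i * star (x j) := by
    intro i j
    have h1 := congrFun (hBv (Pi.single j 1)) i
    simpa [mul_comm] using h1
  have hBij : ∀ i j, B i j = star (B j i) := fun i j => (hB.1.apply i j).symm
  have hsr : star (star x ⬝ᵥ x) = star x ⬝ᵥ x :=
    (star_dotProduct x x).symm
  obtain ⟨k, hk⟩ : ∃ k, x k ≠ 0 := Function.ne_iff.mp hx
  have hk' : star (x k) ≠ 0 := star_ne_zero.mpr hk
  have hkk : ((B k k).re : ℂ) = B k k := Complex.conj_eq_iff_re.mp (hB.1.apply k k)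
  have hN : (Complex.normSq (x k) : ℂ) = x k * star (x k) := (Complex.mul_conj _).symm
  refine ⟨(B k k).re / Complex.normSq (x k), ?_⟩
  ext i j
  have e1 := hBe i j
  have e2 := hBe i k
  have e3 := hBe k k
  have e4 := hBe k i
  have e5 := congrArg star (hBe k i)
  rw [star_mul', star_mul', hsr, star_star, ← hBij] at e5
  have e6 := congrArg star (hBe k k)
  rw [star_mul', star_mul', hsr, star_star, ← hBij] at e6
  rw [Matrix.smul_apply, vecMulVec_apply, Complex.real_smul, Complex.ofReal_div, hkk, hN,
    Pi.star_apply, div_mul_eq_mul_div, eq_div_iff (mul_ne_zero hk hk')]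
  apply mul_left_cancel₀ hs
  linear_combination (x k * star (x k)) * e1 - (x k * star (x j)) * e2 +
    (x k * star (x j)) * e5 - (x i * star (x j)) * e6

/-- In a decomposition of `A` as a sum of `v v*`, any nonzero summand is dominated by `A`, so it
equals `t • A` with `t > 0`; rescale `v` by `1 / √t`. -/
theorem exists_eq_vecMulVec_of_extremal {A : Matrix (Fin n) (Fin n) ℂ} (hA : A.PosSemidef)
    (h : ∀ B : Matrix (Fin n) (Fin n) ℂ, B.PosSemidef → (A - B).PosSemidef →
      ∃ t : ℝ, B = t • A) :
    ∃ y, A = vecMulVec y (star y) := by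
  by_cases h0 : A = 0
  · exact ⟨0, by simp [h0]⟩
  obtain ⟨m, v, hv⟩ := posSemidef_iff_eq_sum_vecMulVec.mp hA
  obtain ⟨i, hi⟩ : ∃ i, v i ≠ 0 := by
    by_contra! hc
    exact h0 (by rw [hv]; simp [hc])
  obtain ⟨t, ht⟩ := h (vecMulVec (v i) (star (v i))) (posSemidef_vecMulVec_self_star _) (by
    rw [hv, ← Finset.add_sum_erase _ _ (Finset.mem_univ i), add_sub_cancel_left]
    exact posSemidef_sum _ fun j _ => posSemidef_vecMulVec_self_star _)
  obtain ⟨k, hk⟩ : ∃ k, v i k ≠ 0 := Function.ne_iff.mp hi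
  have htk := congrArg Complex.re (congrFun (congrFun ht k) k)
  rw [vecMulVec_apply, Pi.star_apply, show star (v i k) = (starRingEnd ℂ) (v i k) from rfl,
    Complex.mul_conj, Complex.ofReal_re, Matrix.smul_apply, Complex.real_smul,
    Complex.re_ofReal_mul] at htk
  have hAk : 0 ≤ (A k k).re := (Complex.le_def.mp (hA.diag_nonneg (i := k))).1
  have htpos : 0 < t := pos_of_mul_pos_left (htk ▸ Complex.normSq_pos.mpr hk) hAk
  refine ⟨(√t : ℂ)⁻¹ • v i, ?_⟩
  have hs : (√t : ℂ) * √t = t := by rw [← Complex.ofReal_mul, Real.mul_self_sqrt htpos.le]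
  have hs0 : (√t : ℂ) ≠ 0 := by exact_mod_cast (Real.sqrt_pos.mpr htpos).ne'
  have hstar : star (√t : ℂ)⁻¹ = (√t : ℂ)⁻¹ := by
    rw [star_inv₀, show star (√t : ℂ) = √t from Complex.conj_ofReal _]
  rw [star_smul, smul_vecMulVec, vecMulVec_smul, ht, smul_smul, ← Complex.coe_smul, smul_smul,
    hstar, ← hs, mul_mul_mul_comm, inv_mul_cancel₀ hs0, one_mul, one_smul]

end PositiveCone
-- Preservers of the positive definite cone
section PositiveDefinitePreservers

variable {n : ℕ}

instance : FiniteDimensional ℝ (HermitianMatrices n) :=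
  FiniteDimensional.of_injective
    ({ toFun := Subtype.val, map_add' := fun _ _ => rfl, map_smul' := fun _ _ => rfl } :
      HermitianMatrices n →ₗ[ℝ] Matrix (Fin n) (Fin n) ℂ) Subtype.val_injective

theorem one_mem_positiveDefiniteMatrices : 1 ∈ positiveDefiniteMatrices n :=
  PosDef.one

theorem span_positiveDefiniteMatrices : Submodule.span ℝ (positiveDefiniteMatrices n) = ⊤ := by
  refine eq_top_iff.mpr fun A _ => ?_
  have hsq : ∀ B : HermitianMatrices n, B ^ 2 + 1 ∈ positiveDefiniteMatrices n := fun B => by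
    have hB : (B : Matrix (Fin n) (Fin n) ℂ)ᴴ = B := B.2
    have h := posSemidef_self_mul_conjTranspose (B : Matrix (Fin n) (Fin n) ℂ)
    rw [hB, ← sq] at h
    exact PosDef.posSemidef_add h PosDef.one
  have hA : A = (1 / 2 : ℝ) • (((A + 1) ^ 2 + 1) - (A ^ 2 + 1) - 1) := by
    apply Subtype.ext
    simp only [selfAdjoint.val_smul, AddSubgroup.coe_sub, AddSubgroup.coe_add,
      selfAdjoint.val_pow, selfAdjoint.val_one]
    rw [show ((A : Matrix (Fin n) (Fin n) ℂ) + 1) ^ 2 + 1 - ((A : Matrix (Fin n) (Fin n) ℂ) ^ 2 + 1)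
      - 1 = (2 : ℝ) • (A : Matrix (Fin n) (Fin n) ℂ) by rw [two_smul]; noncomm_ring, smul_smul]
    norm_num
  rw [hA]
  exact Submodule.smul_mem _ _ (Submodule.sub_mem _ (Submodule.sub_mem _
    (Submodule.subset_span (hsq _)) (Submodule.subset_span (hsq _)))
    (Submodule.subset_span one_mem_positiveDefiniteMatrices))

variable {L : HermitianMatrices n →ₗ[ℝ] HermitianMatrices n}

theorem bijective_of_image_positiveDefiniteMatrices
    (h : L '' positiveDefiniteMatrices n = positiveDefiniteMatrices n) :
    Function.Bijective L := by
  have hs : Function.Surjective L := by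
    rw [← LinearMap.range_eq_top, eq_top_iff, ← span_positiveDefiniteMatrices, Submodule.span_le]
    intro A hA
    rw [← h] at hA
    obtain ⟨B, -, rfl⟩ := hA
    exact ⟨B, rfl⟩
  exact ⟨LinearMap.injective_iff_surjective.mpr hs, hs⟩

/-- Perturb `A` by `ε • 1` and `L A` by `ε • L 1`, both positive definite directions, and let `ε`
tend to `0`. -/
theorem posSemidef_map_iff (h : L '' positiveDefiniteMatrices n = positiveDefiniteMatrices n)
    (A : HermitianMatrices n) :
    (L A : Matrix (Fin n) (Fin n) ℂ).PosSemidef ↔ (A : Matrix (Fin n) (Fin n) ℂ).PosSemidef := by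
  have hL : ∀ B, L B ∈ positiveDefiniteMatrices n ↔ B ∈ positiveDefiniteMatrices n := fun B => by
    conv_lhs => rw [← h]
    exact (bijective_of_image_positiveDefiniteMatrices h).1.mem_set_image
  have key : ∀ A B : HermitianMatrices n, (A : Matrix (Fin n) (Fin n) ℂ).PosSemidef →
      B ∈ positiveDefiniteMatrices n → ∀ ε : ℝ, 0 < ε → A + ε • B ∈ positiveDefiniteMatrices n :=
    fun A B hA hB ε hε => PosDef.posSemidef_add hA (PosDef.smul hB hε)
  constructor
  · refine fun hA => posSemidef_of_forall_add_smul (B := 1) fun ε hε => PosDef.posSemidef ?_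
    refine (hL (A + ε • 1)).mp ?_
    rw [map_add, map_smul]
    exact key _ _ hA ((hL 1).mpr one_mem_positiveDefiniteMatrices) ε hε
  · refine fun hA => posSemidef_of_forall_add_smul (B := L 1) fun ε hε => PosDef.posSemidef ?_
    rw [← map_smul, ← map_add]
    exact (hL _).mpr (key _ _ hA one_mem_positiveDefiniteMatrices ε hε)

theorem exists_map_rankOne_eq_vecMulVec
    (h : L '' positiveDefiniteMatrices n = positiveDefiniteMatrices n) (x : Fin n → ℂ) :
    ∃ y, (L (rankOne x) : Matrix (Fin n) (Fin n) ℂ) = vecMulVec y (star y) := by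
  refine exists_eq_vecMulVec_of_extremal
    ((posSemidef_map_iff h _).mpr (posSemidef_vecMulVec_self_star x)) fun B hB hB' => ?_
  obtain ⟨C, hC⟩ := (bijective_of_image_positiveDefiniteMatrices h).2 ⟨B, hB.1⟩
  obtain rfl : B = (L C : Matrix (Fin n) (Fin n) ℂ) := by rw [hC]
  rw [← AddSubgroup.coe_sub, ← map_sub, posSemidef_map_iff h, AddSubgroup.coe_sub,
    coe_rankOne] at hB'
  obtain ⟨t, ht⟩ := exists_eq_smul_of_le_vecMulVec ((posSemidef_map_iff h C).mp hB) hB'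
  refine ⟨t, ?_⟩
  have hCt : C = t • rankOne x := Subtype.ext ht
  rw [hCt, map_smul, selfAdjoint.val_smul]

/-- `τ` stands for the identity or the transpose, so both forms of the converse are handled at once.
-/
theorem image_positiveDefiniteMatrices_of_congruence {R : Matrix (Fin n) (Fin n) ℂ} (hR : IsUnit R)
    (τ : HermitianMatrices n ≃ HermitianMatrices n)
    (hτ : ∀ A, τ A ∈ positiveDefiniteMatrices n ↔ A ∈ positiveDefiniteMatrices n)
    (hL : ∀ A, (L A : Matrix (Fin n) (Fin n) ℂ) = R * (τ A : Matrix (Fin n) (Fin n) ℂ) * Rᴴ) :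
    L '' positiveDefiniteMatrices n = positiveDefiniteMatrices n := by
  have hpd : ∀ A, L A ∈ positiveDefiniteMatrices n ↔ A ∈ positiveDefiniteMatrices n := fun A => by
    rw [← hτ A]
    change (L A : Matrix (Fin n) (Fin n) ℂ).PosDef ↔ (τ A : Matrix (Fin n) (Fin n) ℂ).PosDef
    rw [hL]
    exact hR.posDef_star_right_conjugate_iff
  refine Set.Subset.antisymm (Set.image_subset_iff.mpr fun A hA => (hpd A).mpr hA) fun B hB => ?_
  obtain ⟨S, hRS⟩ := hR.exists_right_inv
  have hmem : S * (B : Matrix (Fin n) (Fin n) ℂ) * Sᴴ ∈ selfAdjoint _ :=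
    IsSelfAdjoint.conjugate B.2 S
  have hLB : L (τ.symm ⟨_, hmem⟩) = B := by
    apply Subtype.ext
    rw [hL, Equiv.apply_symm_apply]
    calc R * (S * (B : Matrix (Fin n) (Fin n) ℂ) * Sᴴ) * Rᴴ
        = (R * S) * (B : Matrix (Fin n) (Fin n) ℂ) * (R * S)ᴴ := by
          simp only [conjTranspose_mul, mul_assoc]
      _ = B := by rw [hRS, conjTranspose_one, one_mul, mul_one]
  exact ⟨_, (hpd (τ.symm ⟨_, hmem⟩)).mp (by rwa [hLB]), hLB⟩

/-- Transposition of Hermitian matrices. -/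
def transposeHermitian : HermitianMatrices n ≃ HermitianMatrices n where
  toFun A := ⟨(A : Matrix (Fin n) (Fin n) ℂ)ᵀ, IsHermitian.transpose A.2⟩
  invFun A := ⟨(A : Matrix (Fin n) (Fin n) ℂ)ᵀ, IsHermitian.transpose A.2⟩
  left_inv _ := Subtype.ext (transpose_transpose _)
  right_inv _ := Subtype.ext (transpose_transpose _)

end PositiveDefinitePreservers

theorem mainTheorem1 (n : ℕ) (L : HermitianMatrices n →ₗ[ℝ] HermitianMatrices n) :
    L '' positiveDefiniteMatrices n = positiveDefiniteMatrices n ↔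
      ∃ R : Matrix (Fin n) (Fin n) ℂ, IsUnit R ∧
        ((∀ A : HermitianMatrices n,
            (L A : Matrix (Fin n) (Fin n) ℂ) = R * (A : Matrix (Fin n) (Fin n) ℂ) * Rᴴ) ∨
         (∀ A : HermitianMatrices n,
            (L A : Matrix (Fin n) (Fin n) ℂ) = R * (A : Matrix (Fin n) (Fin n) ℂ)ᵀ * Rᴴ)) := by
  constructor
  · intro h
    have h1 : L 1 ∈ positiveDefiniteMatrices n :=
      h ▸ Set.mem_image_of_mem L one_mem_positiveDefiniteMatrices
    exact exists_congruence (F :=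
      { toFun := fun A => (L A : Matrix (Fin n) (Fin n) ℂ)
        map_add' := fun A B => by rw [map_add, AddSubgroup.coe_add]
        map_smul' := fun r A => by rw [map_smul, selfAdjoint.val_smul, RingHom.id_apply] })
      (exists_map_rankOne_eq_vecMulVec h) (PosDef.isUnit h1)
  · rintro ⟨R, hR, hL | hL⟩
    · exact image_positiveDefiniteMatrices_of_congruence hR (Equiv.refl _) (fun _ => Iff.rfl) hL
    · exact image_positiveDefiniteMatrices_of_congruence hR transposeHermitian
        (fun _ => PosDef.transpose_iff) hL
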